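/- Let $\Sigma=\{0,1,2,3\}$ and $n\ge 1$. A line of $\Sigma^m$ is a set of four words that differ in only one coordinate. An $m$-quasigroup is a function $g:\Sigma^m\to\Sigma$ such that, for each $i$ and all fixed values of the other coordinates, every $y\in\Sigma$ equals $g(x_1,\dots,x_m)$ for some $x_i\in\Sigma$. A set $S\subseteq\Sigma^m$ is an MDS code, a double-code, or a double-MDS-code if every line contains, respectively, exactly one, zero or two, or exactly two elements of $S$. A double-code is prime if it is nonempty, is contained in some double-MDS-code, and cannot be split into more than one nonempty double-codes. Write $\chi_S$ for the characteristic function of $S$ and $\oplus$ for addition modulo $2$. Let $g$ be an $n$-quasigroup, let $a\neq b$ be elements of $\Sigma$, and let $S=\{\bar x\in\Sigma^n : g(\bar x)\in\{a,b\}\}$. Then $\chi_S$ has a representation $$\chi_S(\bar x)=\chi_{S_1}(\bar x_{K_1})\oplus\dots\oplus\chi_{S_k}(\bar x_{K_k})\oplus\sigma_0,\qquad(*)$$ where $K_1,\dots,K_k$ is a partition of $\{1,\dots,n\}$ into nonempty blocks, $\bar x_{K_j}=(x_i)_{i\in K_j}$, each $S_j\subseteq\Sigma^{K_j}$ is a prime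 double-MDS-code containing the zero word, and $\sigma_0\in\{0,1\}$. Moreover, for every representation $(*)$: (a) if $1<k<n$, then $g$ is reducible, i.e. it is a superposition of quasigroups of arity less than $n$: there are a partition $L_1,\dots,L_r$ of $\{1,\dots,n\}$ into nonempty blocks, with $r<n$ and all $|L_j|<n$, an $r$-quasigroup $g_0$, and $|L_j|$-quasigroups $g_j$ such that $g(\bar x)=g_0(g_1(\bar x_{L_1}),\dots,g_r(\bar x_{L_r}))$ for all $\bar x\in\Sigma^n$; (b) if $k=n$, then $g$ is semilinear, i.e. $\{(\bar x,g(\bar x)) : \bar x\in\Sigma^n\}\subset\Sigma^{n+1}$ is an MDS code that is contained in a double-MDS-code $T\subset\Sigma^{n+1}$ whose characteristic function has the form $\chi_T(x_1,\dots,x_{n+1})=f_1(x_1)\oplus\dots\oplus f_{n+1}(x_{n+1})$ with $f_i:\Sigma\to\{0,1\}$. -/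

import Mathlib

namespace MDSFour

/-- The alphabet `Σ = {0, 1, 2, 3}`. Words are functions `ι → Sym` on a finite set `ι` of
coordinates; words of length `n` are functions `Fin n → Sym`. -/
abbrev Sym : Type := Fin 4

section Words

variable {ι : Type} [DecidableEq ι]

/-- `g` is a quasigroup of order 4 (`n`-ary if `ι` has `n` elements): in each coordinate `i`, for
arbitrary values of the other coordinates, every `y` is attained by some value of the `i`th one.
As `Sym` is finite, that value is then unique. -/
def IsQuasigroup (g : (ι → Sym) → Sym) : Prop :=
  ∀ (i : ι) (x : ι → Sym) (y : Sym), ∃ t : Sym, g (Function.update x i t) = y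

/-- Number of elements of `S` on the line in direction `i` through `x`; the line is
`{Function.update x i t | t : Sym}`, parametrised injectively by `t`. -/
noncomputable def lineCount (S : Set (ι → Sym)) (i : ι) (x : ι → Sym) : ℕ :=
  {t : Sym | Function.update x i t ∈ S}.ncard

/-- Distance 2 MDS code: each line contains exactly one element. -/
def IsMDSCode (C : Set (ι → Sym)) : Prop :=
  ∀ (i : ι) (x : ι → Sym), lineCount C i x = 1

/-- Double-code: each line contains zero or two elements. -/
def IsDoubleCode (S : Set (ι → Sym)) : Prop :=
  ∀ (i : ι) (x : ι → Sym), lineCount S i x = 0 ∨ lineCount S i x = 2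

/-- Double-MDS-code: each line contains exactly two elements. -/
def IsDoubleMDSCode (S : Set (ι → Sym)) : Prop :=
  ∀ (i : ι) (x : ι → Sym), lineCount S i x = 2

/-- A double-code is complementable if it is a subset of some double-MDS-code. -/
def IsComplementable (S : Set (ι → Sym)) : Prop :=
  IsDoubleCode S ∧ ∃ T : Set (ι → Sym), IsDoubleMDSCode T ∧ S ⊆ T

/-- A double-code is prime if it is complementable, nonempty, and cannot be split into more than
one nonempty double-codes. -/
def IsPrimeDoubleCode (S : Set (ι → Sym)) : Prop :=
  IsComplementable S ∧ S.Nonempty ∧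
    ¬ ∃ A B : Set (ι → Sym), IsDoubleCode A ∧ IsDoubleCode B ∧ A.Nonempty ∧ B.Nonempty ∧
      Disjoint A B ∧ A ∪ B = S

/-- Characteristic function of `S`, with values in `{0, 1}`; the sum `⊕` is that of `ZMod 2`. -/
noncomputable def chi (S : Set (ι → Sym)) : (ι → Sym) → ZMod 2 :=
  S.indicator (fun _ => 1)

/-- Linear double-MDS-code: its characteristic function is a sum of functions of one
coordinate. -/
def IsLinearDoubleMDSCode [Fintype ι] (S : Set (ι → Sym)) : Prop :=
  IsDoubleMDSCode S ∧ ∃ f : ι → Sym → ZMod 2, ∀ x : ι → Sym, chi S x = ∑ i, f i (x i)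

/-- Semilinear MDS code: an MDS code contained in a linear double-MDS-code. -/
def IsSemilinearMDSCode [Fintype ι] (C : Set (ι → Sym)) : Prop :=
  IsMDSCode C ∧ ∃ S : Set (ι → Sym), IsLinearDoubleMDSCode S ∧ C ⊆ S

/-- `M_B(g) = {x | g x ∈ B}`. -/
def levelSet (g : (ι → Sym) → Sym) (B : Set Sym) : Set (ι → Sym) :=
  {x | g x ∈ B}

end Words

variable {n : ℕ}

/-- A representation `χ_S(x) = χ_{S_1}(x_{K_1}) ⊕ ⋯ ⊕ χ_{S_k}(x_{K_k}) ⊕ σ₀`, where `K_1, …, K_k`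
are the (nonempty, pairwise disjoint) blocks of a partition of the set of coordinates and each
`S_j` is a prime double-MDS-code containing the zero word, in the words on the coordinate
set `K_j`. -/
structure PrimeDecomposition (S : Set (Fin n → Sym)) where
  blocks : Finpartition (Finset.univ : Finset (Fin n))
  comp : ∀ K : {K // K ∈ blocks.parts}, Set (K.1 → Sym)
  shift : ZMod 2
  doubleMDS : ∀ K, IsDoubleMDSCode (comp K)
  prime : ∀ K, IsPrimeDoubleCode (comp K)
  zero_mem : ∀ K, (fun _ => 0) ∈ comp K
  chi_eq : ∀ x : Fin n → Sym, chi S x = ∑ K, chi (comp K) (fun i => x i) + shift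

/-- The number `k` of summands of the decomposition. -/
def PrimeDecomposition.numBlocks {S : Set (Fin n → Sym)} (D : PrimeDecomposition S) : ℕ :=
  D.blocks.parts.card

/-- `g` is reducible: it is a superposition `g(x) = g₀(g_1(x_{K_1}), …, g_k(x_{K_k}))`, for some
partition of the set of coordinates into blocks `K_1, …, K_k`, of quasigroups
`g₀, g_1, …, g_k`, all of arity smaller than `n` (`g₀` has arity `k`, and `g_j` has arity
`|K_j|`). Nested superpositions give nothing more: the outermost operation of arity at least two
together with its arguments is of this form. -/
def IsReducible (g : (Fin n → Sym) → Sym) : Prop :=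
  ∃ (P : Finpartition (Finset.univ : Finset (Fin n)))
    (g₀ : ({K // K ∈ P.parts} → Sym) → Sym)
    (h : ∀ K : {K // K ∈ P.parts}, (K.1 → Sym) → Sym),
    P.parts.card < n ∧ (∀ K ∈ P.parts, K.card < n) ∧
      IsQuasigroup g₀ ∧ (∀ K, IsQuasigroup (h K)) ∧
      ∀ x : Fin n → Sym, g x = g₀ (fun K => h K (fun i => x i))

/-- The set `{(x, g(x)) | x ∈ Σⁿ}` of words of length `n + 1`. -/
def graphCode (g : (Fin n → Sym) → Sym) : Set (Fin (n + 1) → Sym) :=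
  Set.range fun x : Fin n → Sym => (Fin.snoc x (g x) : Fin (n + 1) → Sym)

/-- `g` is semilinear: the corresponding MDS code is. -/
def IsSemilinear (g : (Fin n → Sym) → Sym) : Prop :=
  IsSemilinearMDSCode (graphCode g)

end MDSFour

namespace MDSFour

open Finset Function

/-! Regard `chi S` as a balanced 2-coloring `f` and join words of equal color that differ in one
coordinate. Changing the color along direction `i` acts on the connected components as an involution
`flip f i` (`Balanced.flip_congr`, `Balanced.conn_flip_flip`), and these involutions commute
(`Balanced.flip_comm`). An odd rectangle in directions `i`, `j` makes the two involutions agree on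
one component, hence on all of them (`Balanced.conn_flip_of_link`). So when all coordinates are
linked, each color has a single component and the code is prime. With no odd rectangle across two
link classes, `f` is a sum over the classes; this gives the decomposition.

For (a), walk inside one color class of a block `K`. Each step changes the value of `g` for every
setting of the other coordinates or for none. Each color allows only two values of `g`, so the
parity of the number of changes decides whether the values at the ends are equal, independently of
those coordinates. The class is connected, so `K` enters `g` only through one value. For (b), all
blocks are singletons, so `chi S` is itself a sum of functions of one coordinate, and comparing `g
x` with the last letter modulo the pair `{a, b}` gives the linear double-MDS-code. -/

theorem chi_eq_one_iff {ι : Type} (S : Set (ι → Sym)) (x : ι → Sym) : chi S x = 1 ↔ x ∈ S := by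
  by_cases h : x ∈ S <;> simp [chi, h]

theorem chi_eq_chi_iff {κ : Type} {ι : Type} (S : Set (ι → Sym)) (T : Set (κ → Sym)) (x : ι → Sym)
    (y : κ → Sym) : chi S x = chi T y ↔ (x ∈ S ↔ y ∈ T) := by
  by_cases h : x ∈ S <;> by_cases h' : y ∈ T <;> simp [chi, h, h']

/-! ### Connected components of balanced colorings -/

section Coloring

variable {ι : Type} [DecidableEq ι] {f : (ι → Sym) → ZMod 2}

/-- A coloring of the words by `0` and `1` is balanced if each line has two points of each
color. -/
def Balanced (f : (ι → Sym) → ZMod 2) : Prop :=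
  ∀ (i : ι) (x : ι → Sym), #{t : Sym | f (update x i t) = 1} = 2

theorem lineCount_eq_card (S : Set (ι → Sym)) (i : ι) (x : ι → Sym) :
    lineCount S i x = #{t : Sym | chi S (update x i t) = 1} := by
  rw [lineCount, ← Set.ncard_coe_finset]
  congr 1
  ext t
  simp [chi_eq_one_iff]

theorem isDoubleMDSCode_iff_balanced (S : Set (ι → Sym)) :
    IsDoubleMDSCode S ↔ Balanced (chi S) := by
  simp only [IsDoubleMDSCode, Balanced, lineCount_eq_card]

theorem Balanced.add_const (hf : Balanced f) (c : ZMod 2) : Balanced fun x => f x + c := by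
  intro i x
  have key : ∀ (c : ZMod 2) (p : Sym → ZMod 2), #{t | p t = 1} = 2 → #{t | p t + c = 1} = 2 := by
    decide
  exact key c _ (hf i x)

theorem Balanced.exists_ne (hf : Balanced f) (i : ι) (x : ι → Sym) :
    ∃ t, f (update x i t) ≠ f x := by
  have key : ∀ p : Sym → ZMod 2, #{t | p t = 1} = 2 → ∀ s, ∃ t, p t ≠ p s := by decide
  simpa using key _ (hf i x) (x i)

/-- Two parallel lines with points of the same color in corresponding places also have points of
the other color in corresponding places. -/
theorem Balanced.exists_ne_ne (hf : Balanced f) (i : ι) (x y : ι → Sym) (hxy : x i = y i)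
    (h : f x = f y) : ∃ t, f (update x i t) ≠ f x ∧ f (update y i t) ≠ f y := by
  have key : ∀ p : Sym → ZMod 2, #{t | p t = 1} = 2 → ∀ q : Sym → ZMod 2, #{t | q t = 1} = 2 →
      ∀ s, p s = q s → ∃ t, p t ≠ p s ∧ q t ≠ q s := by decide
  have := key _ (hf i x) _ (hf i y) (x i)
  rw [update_eq_self, hxy, update_eq_self] at this
  exact this h

/-- Otherwise the second line would have three points of its color at the starting place: that place
and the two where the first line changes color. -/
theorem Balanced.exists_ne_eq (hf : Balanced f) (i : ι) (x y : ι → Sym) (hxy : x i = y i)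
    (h : f x ≠ f y) : ∃ t, f (update x i t) ≠ f x ∧ f (update y i t) = f x := by
  have key : ∀ p : Sym → ZMod 2, #{t | p t = 1} = 2 → ∀ q : Sym → ZMod 2, #{t | q t = 1} = 2 →
      ∀ s, p s ≠ q s → ∃ t, p t ≠ p s ∧ q t = p s := by decide
  have := key _ (hf i x) _ (hf i y) (x i)
  rw [update_eq_self, hxy, update_eq_self] at this
  exact this h

/-- Two words of the same color that differ in at most one coordinate. -/
def Step (f : (ι → Sym) → ZMod 2) (x y : ι → Sym) : Prop :=
  ∃ i t, y = update x i t ∧ f y = f x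

/-- Two words belong to the same connected component of the same color. -/
abbrev Conn (f : (ι → Sym) → ZMod 2) : (ι → Sym) → (ι → Sym) → Prop :=
  Relation.EqvGen (Step f)

theorem Conn.color_eq {x y : ι → Sym} (h : Conn f x y) : f x = f y := by
  induction h with
  | rel _ _ h => exact h.choose_spec.choose_spec.2.symm
  | refl => rfl
  | symm _ _ _ ih => exact ih.symm
  | trans _ _ _ _ _ ih₁ ih₂ => exact ih₁.trans ih₂

theorem conn_update {x : ι → Sym} {i : ι} {t : Sym} (h : f (update x i t) = f x) :
    Conn f x (update x i t) :=
  .rel _ _ ⟨i, t, rfl, h⟩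

theorem conn_update_update {x : ι → Sym} {i : ι} {s t : Sym}
    (h : f (update x i s) = f (update x i t)) : Conn f (update x i s) (update x i t) :=
  .rel _ _ ⟨i, t, by simp, h.symm⟩

theorem zmod_two_eq_of_ne {a b c : ZMod 2} (h : a ≠ c) (h' : b ≠ c) : a = b := by
  revert a b c; decide

open Classical in
/-- Change the `i`th coordinate so that the color changes. -/
noncomputable def flip (f : (ι → Sym) → ZMod 2) (i : ι) (x : ι → Sym) : ι → Sym :=
  if h : ∃ t, f (update x i t) ≠ f x then update x i h.choose else x

theorem Balanced.color_flip_ne (hf : Balanced f) (i : ι) (x : ι → Sym) :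
    f (flip f i x) ≠ f x := by
  have h := hf.exists_ne i x
  rw [flip, dif_pos h]
  exact h.choose_spec

theorem flip_eq_update (f : (ι → Sym) → ZMod 2) (i : ι) (x : ι → Sym) :
    ∃ t, flip f i x = update x i t := by
  by_cases h : ∃ t, f (update x i t) ≠ f x
  · exact ⟨_, dif_pos h⟩
  · exact ⟨x i, by rw [flip, dif_neg h, update_eq_self]⟩

/-- Both points of the opposite color on a line are adjacent, so the choice made in `flip` is
immaterial up to connectedness. -/
theorem Balanced.conn_flip (hf : Balanced f) {i : ι} {x : ι → Sym} {t : Sym}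
    (h : f (update x i t) ≠ f x) : Conn f (flip f i x) (update x i t) := by
  have h' := hf.color_flip_ne i x
  obtain ⟨s, hs⟩ := flip_eq_update f i x
  rw [hs] at h' ⊢
  exact conn_update_update (zmod_two_eq_of_ne h' h)

theorem Balanced.conn_flip_flip (hf : Balanced f) (i : ι) (x : ι → Sym) :
    Conn f (flip f i (flip f i x)) x := by
  have h' := hf.color_flip_ne i x
  obtain ⟨s, hs⟩ := flip_eq_update f i x
  have hx : update (flip f i x) i (x i) = x := by simp [hs]
  have := hf.conn_flip (i := i) (x := flip f i x) (t := x i) (by rw [hx]; exact h'.symm)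
  rwa [hx] at this

theorem Balanced.flip_congr (hf : Balanced f) (i : ι) {x y : ι → Sym} (h : Conn f x y) :
    Conn f (flip f i x) (flip f i y) := by
  induction h with
  | rel x y h =>
    obtain ⟨j, t, rfl, h⟩ := h
    by_cases hij : i = j
    · subst hij
      have h' := hf.color_flip_ne i (update x i t)
      obtain ⟨s, hs⟩ := flip_eq_update f i (update x i t)
      rw [update_idem] at hs
      rw [hs] at h' ⊢
      exact hf.conn_flip (h ▸ h')
    -- The two parallel lines change color at a common place `u`, and the points found there differ
    -- only in coordinate `j`.
    · obtain ⟨u, hu, hu'⟩ := hf.exists_ne_ne i x (update x j t) (by simp [hij]) h.symm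
      refine (hf.conn_flip hu).trans _ _ _ (.trans _ _ _ ?_ (hf.conn_flip hu').symm)
      rw [update_comm (Ne.symm hij)] at hu' ⊢
      exact conn_update (zmod_two_eq_of_ne hu' (h ▸ hu))
  | refl => exact .refl _
  | symm _ _ _ ih => exact ih.symm
  | trans _ _ _ _ _ ih₁ ih₂ => exact ih₁.trans _ _ _ ih₂

/-- There is a rectangle at `x` whose two neighboring corners have the other color and whose
opposite corner has the color of `x`; both orders of flipping lead to the component of that corner.
-/
theorem Balanced.flip_comm (hf : Balanced f) (i j : ι) (x : ι → Sym) :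
    Conn f (flip f i (flip f j x)) (flip f j (flip f i x)) := by
  by_cases hij : i = j
  · subst hij
    exact .refl _
  obtain ⟨t, ht⟩ := hf.exists_ne j x
  obtain ⟨s, hs, hs'⟩ := hf.exists_ne_eq i x (update x j t) (by simp [hij]) ht.symm
  have h₁ := (hf.flip_congr i (hf.conn_flip ht)).trans _ _ _
    (hf.conn_flip (x := update x j t) (t := s) (by rw [hs']; exact ht.symm))
  have h₂ := (hf.flip_congr j (hf.conn_flip hs)).trans _ _ _
    (hf.conn_flip (x := update x i s) (t := t)
      (by rw [update_comm hij, hs']; exact hs.symm))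
  rw [update_comm hij] at h₂
  exact h₁.trans _ _ _ h₂.symm

/-- The coordinates `i` and `j` are linked if some rectangle in these directions has an odd number
of points of color `1`. -/
def Link (f : (ι → Sym) → ZMod 2) (i j : ι) : Prop :=
  ∃ z s t, f (update (update z i s) j t) + f z ≠ f (update z i s) + f (update z j t)

theorem Balanced.exists_conn_flip_of_link (hf : Balanced f) {i j : ι} (h : Link f i j) :
    ∃ x, Conn f (flip f i x) (flip f j x) := by
  by_cases hij : i = j
  · subst hij
    exact ⟨fun _ => 0, .refl _⟩
  obtain ⟨z, s, t, h⟩ := h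
  -- Here `x` is the corner whose color differs from that of the other three; its two neighbors are
  -- connected through the opposite corner. An odd rectangle always has such a corner, and the four
  -- cases below place it.
  have key : ∀ x s t, f (update x i s) ≠ f x → f (update x j t) ≠ f x →
      f (update (update x i s) j t) ≠ f x → Conn f (flip f i x) (flip f j x) := by
    intro x s t h₁ h₂ h₃
    refine (hf.conn_flip h₁).trans _ _ _ (.trans _ _ _ ?_ (hf.conn_flip h₂).symm)
    refine (conn_update (zmod_two_eq_of_ne h₃ h₁)).trans _ _ _ ?_
    rw [update_comm hij] at h₃ ⊢
    exact (conn_update (zmod_two_eq_of_ne h₃ h₂)).symm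
  have e : update (update z i s) j t = update (update z j t) i s := update_comm hij _ _ _
  have hz₁ := key z s t
  have hz₂ := key (update z i s) (z i) t
  have hz₃ := key (update z j t) s (z j)
  have hz₄ := key (update (update z i s) j t) (z i) (z j)
  have e₂ : update (update (update z i s) i (z i)) j t = update z j t := by simp
  have e₃ : update (update (update z j t) i s) j (z j) = update z i s := by simp [← e, Ne.symm hij]
  have e₄ : update (update (update z i s) j t) i (z i) = update z j t := by simp [e, hij]
  have e₅ : update (update z j t) j (z j) = z := by simp
  have e₆ : update (update (update z i s) j t) j (z j) = update z i s := by simp [Ne.symm hij]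
  have e₇ : update (update z i s) i (z i) = z := by simp
  rw [e₂, e₇] at hz₂
  rw [e₃, e₅, ← e] at hz₃
  rw [e₄, e₅, e₆] at hz₄
  have cases : ∀ p q r w : ZMod 2, w + p ≠ q + r → (q ≠ p ∧ r ≠ p ∧ w ≠ p) ∨
      (p ≠ q ∧ w ≠ q ∧ r ≠ q) ∨ (w ≠ r ∧ p ≠ r ∧ q ≠ r) ∨ (r ≠ w ∧ q ≠ w ∧ p ≠ w) := by
    unfold ZMod; decide
  rcases cases _ _ _ _ h with ⟨h₁, h₂, h₃⟩ | ⟨h₁, h₂, h₃⟩ | ⟨h₁, h₂, h₃⟩ | ⟨h₁, h₂, h₃⟩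
  exacts [⟨_, hz₁ h₁ h₂ h₃⟩, ⟨_, hz₂ h₁ h₂ h₃⟩, ⟨_, hz₃ h₁ h₂ h₃⟩, ⟨_, hz₄ h₁ h₂ h₃⟩]

theorem forall_of_forall_update [Finite ι] {P : (ι → Sym) → Prop} (z : ι → Sym) (hz : P z)
    (hP : ∀ x i t, P x → P (update x i t)) (x : ι → Sym) : P x := by
  have := Fintype.ofFinite ι
  have key : ∀ A : Finset ι, P (A.piecewise x z) := by
    intro A
    induction A using Finset.induction_on with
    | empty => simpa using hz
    | insert i A _ ih =>
      rw [piecewise_insert]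
      exact hP _ _ _ ih
  simpa using key univ

theorem Balanced.conn_flip_of_link [Finite ι] (hf : Balanced f) {i j : ι} (h : Link f i j)
    (x : ι → Sym) : Conn f (flip f i x) (flip f j x) := by
  obtain ⟨z, hz⟩ := hf.exists_conn_flip_of_link h
  refine forall_of_forall_update (P := fun x => Conn f (flip f i x) (flip f j x)) z hz (fun x k t ih => ?_) x
  have congr : ∀ {x y}, Conn f x y → Conn f (flip f i x) (flip f j x) →
      Conn f (flip f i y) (flip f j y) := fun hxy ih =>
    (hf.flip_congr i hxy).symm.trans _ _ _ (ih.trans _ _ _ (hf.flip_congr j hxy))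
  -- A change of letter either stays in the component or acts on it as `flip f k`, which commutes
  -- with both flips.
  by_cases hx : f (update x k t) = f x
  · exact congr (conn_update hx) ih
  · exact congr (hf.conn_flip hx) ((hf.flip_comm i k x).trans _ _ _
      ((hf.flip_congr k ih).trans _ _ _ (hf.flip_comm k j x)))

theorem Balanced.conn_flip_of_eqvGen [Finite ι] (hf : Balanced f) {i j : ι}
    (h : Relation.EqvGen (Link f) i j) (x : ι → Sym) :
    Conn f (flip f i x) (flip f j x) := by
  induction h with
  | rel _ _ h => exact hf.conn_flip_of_link h x
  | refl => exact .refl _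
  | symm _ _ _ ih => exact ih.symm
  | trans _ _ _ _ _ ih₁ ih₂ => exact ih₁.trans _ _ _ ih₂

/-- If all coordinates are linked, then the points of each color form a connected set. -/
theorem Balanced.conn_of_linked [Finite ι] (hf : Balanced f)
    (hl : ∀ i j, Relation.EqvGen (Link f) i j) {x y : ι → Sym} (hxy : f x = f y) :
    Conn f x y := by
  -- All flips of `x` lie in one component, so the component of `x` and that one exhaust the words.
  have key : ∀ y, (f y = f x → Conn f x y) ∧ (f y ≠ f x → ∀ i, Conn f (flip f i x) y) := by
    refine forall_of_forall_update x ⟨fun _ => .refl _, fun h => (h rfl).elim⟩ ?_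
    rintro y i t ⟨ih₁, ih₂⟩
    by_cases ht : f (update y i t) = f y
    · rw [ht]
      exact ⟨fun h => (ih₁ h).trans _ _ _ (conn_update ht),
        fun h k => (ih₂ h k).trans _ _ _ (conn_update ht)⟩
    · refine ⟨fun h => ?_, fun h k => ?_⟩
      · exact (hf.conn_flip_flip i x).symm.trans _ _ _
          ((hf.flip_congr i (ih₂ (fun h' => ht (h.trans h'.symm)) i)).trans _ _ _
            (hf.conn_flip ht))
      · exact (hf.conn_flip_of_eqvGen (hl k i) x).trans _ _ _
          ((hf.flip_congr i (ih₁ (zmod_two_eq_of_ne (Ne.symm ht) (Ne.symm h)))).trans _ _ _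
            (hf.conn_flip ht))
  exact (key y).1 hxy.symm

theorem isPrimeDoubleCode_of_linked [Finite ι] {S : Set (ι → Sym)} (hS : IsDoubleMDSCode S)
    (hne : S.Nonempty) (hl : ∀ i j, Relation.EqvGen (Link (chi S)) i j) :
    IsPrimeDoubleCode S := by
  refine ⟨⟨fun i x => .inr (hS i x), S, hS, subset_rfl⟩, hne, ?_⟩
  rintro ⟨A, B, hA, -, ⟨x, hx⟩, ⟨y, hy⟩, hAB, rfl⟩
  have hf := (isDoubleMDSCode_iff_balanced _).1 hS
  -- A line meeting `A` has two points in `A` and only two in `A ∪ B`, so `A` takes them all and is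
  -- a union of components.
  have step : ∀ x i t, x ∈ A → update x i t ∈ A ∪ B → update x i t ∈ A := by
    intro x i t hx ht
    have hsub : {s | update x i s ∈ A} ⊆ {s | update x i s ∈ A ∪ B} := fun s hs => .inl hs
    have h0 : lineCount A i x ≠ 0 := by
      rw [lineCount, Ne, Set.ncard_eq_zero, ← Ne, ← Set.nonempty_iff_ne_empty]
      exact ⟨x i, by simpa using hx⟩
    have h2 := (hA i x).resolve_left h0
    exact (Set.eq_of_subset_of_ncard_le hsub (by
      rw [← lineCount, ← lineCount, h2, hS i x]) : _ = _).symm.subset ht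
  have key : ∀ x y, Conn (chi (A ∪ B)) x y → (x ∈ A ↔ y ∈ A) := by
    intro x y h
    induction h with
    | rel x y h =>
      obtain ⟨i, t, rfl, h⟩ := h
      rw [chi_eq_chi_iff] at h
      refine ⟨fun hx => step x i t hx (h.2 (.inl hx)), fun hx => ?_⟩
      have := step _ i (x i) hx
      simp only [update_idem, update_eq_self] at this
      exact this (h.1 (.inl hx))
    | refl => rfl
    | symm _ _ _ ih => exact ih.symm
    | trans _ _ _ _ _ ih₁ ih₂ => exact ih₁.trans ih₂
  have hxy : Conn (chi (A ∪ B)) x y := hf.conn_of_linked hl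
    ((chi_eq_chi_iff _ _ _ _).2 ⟨fun _ => .inr hy, fun _ => .inl hx⟩)
  exact Set.disjoint_left.1 hAB ((key x y hxy).1 hx) hy

/-- Both a prime double-MDS-code and its complement are connected. -/
theorem IsPrimeDoubleCode.conn {S : Set (ι → Sym)} (hS : IsPrimeDoubleCode S)
    (hM : IsDoubleMDSCode S) [Nonempty ι] {x y : ι → Sym} (hxy : chi S x = chi S y) :
    Conn (chi S) x y := by
  have hf := (isDoubleMDSCode_iff_balanced _).1 hM
  have inside : ∀ x y, x ∈ S → y ∈ S → Conn (chi S) x y := by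
    intro x y hx hy
    by_contra hc
    -- Any union of components inside `S` is a double-code, so two components would split `S`.
    have hcode : ∀ A : Set (ι → Sym), A ⊆ S →
        (∀ u v, Conn (chi S) u v → u ∈ A → v ∈ A) → IsDoubleCode A := by
      intro A hAS hA i u
      by_cases h : ∃ t, update u i t ∈ A
      · right
        obtain ⟨t, ht⟩ := h
        rw [← hM i u, lineCount, lineCount]
        congr 1
        ext s
        refine ⟨fun hs => hAS hs, fun hs => hA _ _ (conn_update_update ?_) ht⟩
        exact (chi_eq_chi_iff _ _ _ _).2 ⟨fun _ => hs, fun _ => hAS ht⟩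
      · left
        rw [lineCount, Set.ncard_eq_zero]
        exact Set.eq_empty_of_forall_notMem fun t ht => h ⟨t, ht⟩
    have mem : ∀ u v, Conn (chi S) u v → u ∈ S → v ∈ S := fun u v h =>
      ((chi_eq_chi_iff _ _ _ _).1 h.color_eq).1
    refine hS.2.2 ⟨{z | z ∈ S ∧ Conn (chi S) x z}, {z | z ∈ S ∧ ¬ Conn (chi S) x z},
      hcode _ (fun _ h => h.1) fun u v h hu => ⟨mem u v h hu.1, hu.2.trans _ _ _ h⟩,
      hcode _ (fun _ h => h.1) fun u v h hu =>
        ⟨mem u v h hu.1, fun h' => hu.2 (h'.trans _ _ _ h.symm)⟩,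
      ⟨x, hx, .refl _⟩, ⟨y, hy, hc⟩, Set.disjoint_left.2 fun z h h' => h'.2 h.2, ?_⟩
    ext z
    by_cases h : Conn (chi S) x z <;> simp [h]
  by_cases hx : x ∈ S
  · exact inside x y hx (((chi_eq_chi_iff _ _ _ _).1 hxy).1 hx)
  · have hy : y ∉ S := fun hy => hx (((chi_eq_chi_iff _ _ _ _).1 hxy).2 hy)
    have i : ι := Classical.arbitrary ι
    -- Connectedness of the complement is transported from `S` by flipping there and back.
    have hflip : ∀ z, z ∉ S → flip (chi S) i z ∈ S := by
      intro z hz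
      have := hf.color_flip_ne i z
      rw [Ne, chi_eq_chi_iff] at this
      tauto
    exact (hf.conn_flip_flip i x).symm.trans _ _ _ ((hf.flip_congr i
      (inside _ _ (hflip x hx) (hflip y hy))).trans _ _ _ (hf.conn_flip_flip i y))

end Coloring

/-! ### Additive splitting along link classes -/

section Decomposition

variable {ι : Type} [DecidableEq ι] {f : (ι → Sym) → ZMod 2}

theorem eq_of_not_link {i j : ι} (h : ¬ Link f i j) (z : ι → Sym) (s t : Sym) :
    f (update (update z i s) j t) - f (update z i s) = f (update z j t) - f z := by
  have := not_not.1 fun h' => h ⟨z, s, t, h'⟩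
  rw [sub_eq_sub_iff_add_eq_add, this, add_comm]

theorem sub_eq_of_not_link_update {B : Finset ι} {j : ι} (h : ∀ i ∈ B, ¬ Link f i j)
    (x z : ι → Sym) (t : Sym) :
    f (update (B.piecewise x z) j t) - f (B.piecewise x z) = f (update z j t) - f z := by
  induction B using Finset.induction_on with
  | empty => simp
  | insert i B _ ih =>
    rw [piecewise_insert, eq_of_not_link (h i (mem_insert_self _ _)),
      ih fun k hk => h k (mem_insert_of_mem hk)]

theorem sub_eq_of_not_link {A B : Finset ι} (hAB : Disjoint A B)
    (h : ∀ i ∈ B, ∀ j ∈ A, ¬ Link f i j) (x z : ι → Sym) :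
    f ((A ∪ B).piecewise x z) - f (B.piecewise x z) = f (A.piecewise x z) - f z := by
  induction A using Finset.induction_on with
  | empty =>
    have : (∅ ∪ B).piecewise x z = B.piecewise x z := by
      ext k
      simp [Finset.piecewise]
    simp [this]
  | insert j A hj ih =>
    rw [disjoint_insert_left] at hAB
    have ih := ih hAB.2 fun i hi k hk => h i hi k (mem_insert_of_mem hk)
    have hc : (A ∪ B).piecewise x z = B.piecewise x (A.piecewise x z) := by
      ext k
      by_cases hA : k ∈ A <;> by_cases hB : k ∈ B <;> simp [Finset.piecewise, hA, hB]
    have := sub_eq_of_not_link_update (fun i hi => h i hi j (mem_insert_self _ _)) x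
      (A.piecewise x z) (x j)
    rw [← hc] at this
    rw [insert_union, piecewise_insert, piecewise_insert, ← sub_add_sub_cancel, ih, this,
      sub_add_sub_cancel]

theorem eq_add_sum_of_not_link {P : Finset (Finset ι)}
    (hd : (P : Set (Finset ι)).PairwiseDisjoint id)
    (h : ∀ A ∈ P, ∀ B ∈ P, A ≠ B → ∀ i ∈ A, ∀ j ∈ B, ¬ Link f i j) (x z : ι → Sym) :
    f ((P.biUnion id).piecewise x z) = f z + ∑ K ∈ P, (f (K.piecewise x z) - f z) := by
  induction P using Finset.induction_on with
  | empty =>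
    have : ((∅ : Finset (Finset ι)).biUnion id).piecewise x z = z := by
      ext k
      simp [Finset.piecewise]
    rw [this]
    simp
  | insert A P hA ih =>
    have ih := ih (hd.subset (by simp)) fun B hB C hC => h B (mem_insert_of_mem hB) C
      (mem_insert_of_mem hC)
    have hne : ∀ B ∈ P, B ≠ A := fun B hB e => hA (e ▸ hB)
    rw [biUnion_insert, sum_insert hA, add_left_comm, ← ih, id, ← sub_eq_iff_eq_add]
    refine sub_eq_of_not_link ?_ ?_ x z
    · rw [disjoint_biUnion_right]
      exact fun B hB => hd (by simp) (by simp [hB]) (hne B hB).symm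
    · intro i hi j hj
      obtain ⟨B, hB, hi⟩ := mem_biUnion.1 hi
      exact h B (mem_insert_of_mem hB) A (mem_insert_self _ _) (hne B hB) i hi j hj

/-- The word equal to `u` on `K` and to `z` elsewhere. -/
def glue (K : Finset ι) (u : K → Sym) (z : ι → Sym) : ι → Sym :=
  fun i => if h : i ∈ K then u ⟨i, h⟩ else z i

theorem glue_restrict (K : Finset ι) (x z : ι → Sym) :
    glue K (fun i => x i) z = K.piecewise x z := by
  ext i
  by_cases h : i ∈ K <;> simp [glue, h]

theorem glue_update (K : Finset ι) (u : K → Sym) (z : ι → Sym) (i : K) (t : Sym) :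
    glue K (update u i t) z = update (glue K u z) i t := by
  ext j
  by_cases h : j ∈ K
  · by_cases hj : (⟨j, h⟩ : K) = i
    · subst hj
      simp [glue, h]
    · have hj' : j ≠ i := fun e => hj (Subtype.ext e)
      simp [glue, h, hj, hj']
  · have hj : j ≠ i := fun e => h (e ▸ i.2)
    simp [glue, h, hj]

theorem restrict_glue_self (K : Finset ι) (u : K → Sym) (z : ι → Sym) :
    (fun i : K => glue K u z i) = u := by
  ext i
  simp [glue]

theorem restrict_glue_of_disjoint {K L : Finset ι} (h : Disjoint L K) (u : K → Sym)
    (z : ι → Sym) : (fun i : L => glue K u z i) = fun i : L => z i := by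
  ext i
  simp [glue, disjoint_left.1 h i.2]

theorem glue_zero (K : Finset ι) : glue K (fun _ => 0) (fun _ => 0) = fun _ => 0 := by
  ext i
  simp [glue]

/-- Projection of a coloring to the coordinates in `K`, normalized at the zero word. -/
def component (f : (ι → Sym) → ZMod 2) (K : Finset ι) : Set (K → Sym) :=
  {u | f (glue K u fun _ => 0) = f fun _ => 0}

theorem chi_component (f : (ι → Sym) → ZMod 2) (K : Finset ι) (u : K → Sym) :
    chi (component f K) u = f (glue K u fun _ => 0) + (f (fun _ => 0) + 1) := by
  have key : ∀ p q : ZMod 2, (p = q → 1 = p + (q + 1)) ∧ (p ≠ q → 0 = p + (q + 1)) := by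
    unfold ZMod; decide
  by_cases h : f (glue K u fun _ => 0) = f fun _ => 0
  · rw [← (key _ _).1 h]
    exact (chi_eq_one_iff _ _).2 h
  · rw [← (key _ _).2 h]
    exact Set.indicator_of_notMem (s := component f K) h _

theorem zero_mem_component (f : (ι → Sym) → ZMod 2) (K : Finset ι) :
    (fun _ => 0 : K → Sym) ∈ component f K := by
  simp [component, glue_zero]

theorem Balanced.component (hf : Balanced f) (K : Finset ι) :
    IsDoubleMDSCode (component f K) := by
  rw [isDoubleMDSCode_iff_balanced]
  intro i u
  simp only [chi_component, glue_update]
  exact hf.add_const (f (fun _ => 0) + 1) i _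

theorem link_component [Fintype ι] {K : Finset ι} {i j : ι} (hi : i ∈ K) (hj : j ∈ K)
    (hK : ∀ i ∉ K, ∀ j ∈ K, ¬ Link f i j) (h : Link f i j) :
    Link (chi (component f K)) ⟨i, hi⟩ ⟨j, hj⟩ := by
  obtain ⟨z, s, t, h⟩ := h
  -- The part of `f` outside `K` is constant on a rectangle with directions in `K`, so projecting to
  -- `K` preserves its parity.
  have split : ∀ x, f x = f (K.piecewise x fun _ => 0) +
      (f (Kᶜ.piecewise x fun _ => 0) - f fun _ => 0) := by
    intro x
    have := sub_eq_of_not_link disjoint_compl_right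
      (fun i hi j hj => hK i (mem_compl.1 hi) j hj) x fun _ => 0
    rw [union_compl, piecewise_univ, sub_eq_iff_eq_add] at this
    rw [this]
    ring
  have hupd : ∀ (x : ι → Sym) (k : ι) (v : Sym), k ∈ K →
      Kᶜ.piecewise (update x k v) (fun _ => 0) = Kᶜ.piecewise x fun _ => 0 := by
    intro x k v hk
    ext l
    by_cases hl : l ∈ K
    · simp [hl]
    · have : l ≠ k := fun e => hl (e ▸ hk)
      simp [hl, this]
  refine ⟨fun k => z k, s, t, fun h' => h ?_⟩
  have hpw : ∀ (x : ι → Sym) (k : ι) (v : Sym), k ∈ K →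
      K.piecewise (update x k v) (fun _ => 0) = update (K.piecewise x fun _ => 0) k v := by
    intro x k v hk
    rw [← glue_restrict, ← glue_restrict, ← glue_update K _ _ ⟨k, hk⟩]
    congr 1
    ext l
    by_cases hl : l = ⟨k, hk⟩
    · subst hl; simp
    · have : (l : ι) ≠ k := fun e => hl (Subtype.ext e)
      simp [hl, this]
  simp only [chi_component, glue_update, glue_restrict] at h'
  rw [split (update _ _ _), split z, split (update z i s), split (update z j t)]
  simp only [hupd _ _ _ hi, hupd _ _ _ hj, hpw _ _ _ hi, hpw _ _ _ hj]
  linear_combination h'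

theorem eqvGen_link_component [Fintype ι] {K : Finset ι}
    (hK : ∀ i j, Relation.EqvGen (Link f) i j → (i ∈ K ↔ j ∈ K)) {i j : ι}
    (h : Relation.EqvGen (Link f) i j) (hi : i ∈ K) (hj : j ∈ K) :
    Relation.EqvGen (Link (chi (component f K))) ⟨i, hi⟩ ⟨j, hj⟩ := by
  induction h with
  | rel i j h =>
    exact .rel _ _ (link_component hi hj (fun k hk l hl h => hk ((hK k l (.rel _ _ h)).2 hl)) h)
  | refl => exact .refl _
  | symm _ _ _ ih => exact (ih hj hi).symm
  | trans i k j h₁ _ ih₁ ih₂ =>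
    have hk := (hK _ _ h₁).1 hi
    exact (ih₁ hi hk).trans _ _ _ (ih₂ hk hj)

theorem exists_primeDecomposition {n : ℕ} {S : Set (Fin n → Sym)} (hS : IsDoubleMDSCode S) :
    Nonempty (PrimeDecomposition S) := by
  classical
  have hf := (isDoubleMDSCode_iff_balanced _).1 hS
  let r : Setoid (Fin n) := Relation.EqvGen.setoid (Link (chi S))
  let P := Finpartition.ofSetoid r
  have hP : ∀ K ∈ P.parts, ∀ i ∈ K, ∀ j, j ∈ K ↔ Relation.EqvGen (Link (chi S)) i j := by
    intro K hK i hi j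
    rw [← P.part_eq_of_mem hK hi]
    exact Finpartition.mem_part_ofSetoid_iff_rel
  refine ⟨⟨P, fun K => component (chi S) K.1,
    -- Each component is normalized to color `1` at the zero word; the shift corrects for this once
    -- per block.
    chi S (fun _ => 0) - ∑ K : {K // K ∈ P.parts}, 1, fun K => hf.component K.1,
    fun K => isPrimeDoubleCode_of_linked (hf.component K.1) ⟨_, zero_mem_component _ _⟩ ?_,
    fun K => zero_mem_component _ _, ?_⟩⟩
  · rintro ⟨i, hi⟩ ⟨j, hj⟩
    refine eqvGen_link_component (fun k l hkl => ?_) ((hP K.1 K.2 i hi j).1 hj) hi hj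
    rw [hP K.1 K.2 i hi, hP K.1 K.2 i hi]
    exact ⟨fun h => h.trans _ _ _ hkl, fun h => h.trans _ _ _ hkl.symm⟩
  · intro x
    have := eq_add_sum_of_not_link (f := chi S) P.disjoint (fun A hA B hB hAB i hi j hj h =>
      hAB (P.eq_of_mem_parts hA hB ((hP A hA i hi i).2 (.refl _))
        ((hP B hB j hj i).2 (.symm _ _ (.rel _ _ h))))) x fun _ => 0
    rw [P.biUnion_parts, piecewise_univ, ← sum_coe_sort] at this
    rw [this]
    have hsum : ∑ K : {K // K ∈ P.parts}, (chi S (K.1.piecewise x fun _ => 0) - chi S fun _ => 0) =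
        ∑ K : {K // K ∈ P.parts}, (chi (component (chi S) K.1) (fun i => x i) - 1) := by
      refine sum_congr rfl fun K _ => ?_
      rw [chi_component, glue_restrict, CharTwo.sub_eq_add]
      ring
    rw [hsum, sum_sub_distrib]
    ring

end Decomposition

/-! ### Level sets and restrictions of quasigroups -/

section Quasigroup

variable {ι : Type} [DecidableEq ι] {g : (ι → Sym) → Sym}

theorem IsQuasigroup.bijective (hg : IsQuasigroup g) (i : ι) (x : ι → Sym) :
    Bijective fun t => g (update x i t) :=
  Finite.surjective_iff_bijective.1 (hg i x)

/-- A pair and its complement in a four-letter alphabet have the same size, so the truth value of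
`p` is irrelevant. -/
theorem ncard_mem_pair_iff {a b : Sym} (hab : a ≠ b) {e : Sym → Sym} (he : Bijective e)
    (p : Prop) : {t | e t ∈ ({a, b} : Set Sym) ↔ p}.ncard = 2 := by
  have h : ∀ s : Set Sym, (e ⁻¹' s).ncard = s.ncard := fun s =>
    Set.ncard_preimage_of_injective_subset_range he.1 (by simp [he.2.range_eq])
  by_cases hp : p
  · have : {t | e t ∈ ({a, b} : Set Sym) ↔ p} = e ⁻¹' {a, b} := by
      ext; simp [hp]
    rw [this, h, Set.ncard_pair hab]
  · have : {t | e t ∈ ({a, b} : Set Sym) ↔ p} = e ⁻¹' {a, b}ᶜ := by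
      ext; simp [hp]
    rw [this, h, Set.ncard_compl, Set.ncard_pair hab]
    simp

theorem IsQuasigroup.isDoubleMDSCode_levelSet (hg : IsQuasigroup g) {a b : Sym} (hab : a ≠ b) :
    IsDoubleMDSCode (levelSet g {a, b}) := by
  intro i x
  simpa only [iff_true] using! ncard_mem_pair_iff hab (hg.bijective i x) True

theorem IsQuasigroup.glue (hg : IsQuasigroup g) (K : Finset ι) (z : ι → Sym) :
    IsQuasigroup fun u : K → Sym => g (glue K u z) := by
  intro i u y
  simp only [glue_update]
  exact hg i _ y

theorem IsQuasigroup.surjective [Nonempty ι] (hg : IsQuasigroup g) : Surjective g := fun y =>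
  let ⟨_, ht⟩ := hg (Classical.arbitrary ι) (fun _ => 0) y
  ⟨_, ht⟩

end Quasigroup

/-! ### Reducibility for an intermediate number of blocks -/

section Reducible

variable {n : ℕ} {g : (Fin n → Sym) → Sym} {a b : Sym}

theorem PrimeDecomposition.chi_glue_eq_iff {S : Set (Fin n → Sym)} (D : PrimeDecomposition S)
    (K : {K // K ∈ D.blocks.parts}) (u v : K.1 → Sym) (z : Fin n → Sym) :
    chi S (glue K.1 u z) = chi S (glue K.1 v z) ↔ chi (D.comp K) u = chi (D.comp K) v := by
  have hsum : ∀ w : K.1 → Sym, chi S (glue K.1 w z) = chi (D.comp K) w +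
      (∑ L ∈ univ.erase K, chi (D.comp L) (fun i => z i) + D.shift) := by
    intro w
    rw [D.chi_eq, ← add_sum_erase _ _ (mem_univ K), restrict_glue_self, add_assoc]
    congr 2
    refine sum_congr rfl fun L hL => ?_
    rw [restrict_glue_of_disjoint]
    exact D.blocks.disjoint L.2 K.2 fun h => ne_of_mem_erase hL (Subtype.ext h)
  rw [hsum, hsum, add_left_inj]

/-- The value of `g` at `glue K u z` depends only on `z` and on the value at `glue K u z'`. -/
theorem PrimeDecomposition.apply_glue_eq (hg : IsQuasigroup g) (hab : a ≠ b)
    (D : PrimeDecomposition (levelSet g {a, b})) (K : {K // K ∈ D.blocks.parts})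
    {u v : K.1 → Sym} {z' : Fin n → Sym} (h : g (glue K.1 u z') = g (glue K.1 v z'))
    (z : Fin n → Sym) : g (glue K.1 u z) = g (glue K.1 v z) := by
  have hK : Nonempty K.1 := (D.blocks.nonempty_of_mem_parts K.2).to_subtype
  have hmem : ∀ {u v : K.1 → Sym}, chi (D.comp K) u = chi (D.comp K) v →
      ∀ z, g (glue K.1 u z) ∈ ({a, b} : Set Sym) ↔ g (glue K.1 v z) ∈ ({a, b} : Set Sym) :=
    fun h z => (chi_eq_chi_iff _ _ _ _).1 ((D.chi_glue_eq_iff K _ _ z).2 h)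
  -- Two successive changes among only two available values return to the start.
  have pair : ∀ a b p q r : Sym, a ≠ b → (p = a ∨ p = b ↔ q = a ∨ q = b) →
      (q = a ∨ q = b ↔ r = a ∨ r = b) → p ≠ q → q ≠ r → p = r := by decide
  have key : ∀ u v, Conn (chi (D.comp K)) u v →
      (∀ z, g (glue K.1 u z) = g (glue K.1 v z)) ∨ ∀ z, g (glue K.1 u z) ≠ g (glue K.1 v z) := by
    intro u v huv
    induction huv with
    | rel u v h =>
      obtain ⟨i, t, rfl, -⟩ := h
      have hinj : ∀ z, g (glue K.1 u z) = g (glue K.1 (update u i t) z) ↔ u i = t := by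
        intro z
        have := ((hg.glue K.1 z).bijective i u).1.eq_iff (a := u i) (b := t)
        simpa only [update_eq_self] using this
      simp only [Ne, hinj]
      by_cases hut : u i = t <;> simp [hut]
    | refl => exact .inl fun _ => rfl
    | symm _ _ _ ih => exact ih.imp (fun h z => (h z).symm) fun h z => (h z).symm
    | trans u v w h₁ h₂ ih₁ ih₂ =>
      rcases ih₁ with ih₁ | ih₁
      · simpa only [ih₁] using ih₂
      rcases ih₂ with ih₂ | ih₂
      · exact .inr fun z => ih₂ z ▸ ih₁ z
      · exact .inl fun z => pair a b _ _ _ hab (hmem (Conn.color_eq h₁) z) (hmem (Conn.color_eq h₂) z)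
          (ih₁ z) (ih₂ z)
  have hchi : chi (D.comp K) u = chi (D.comp K) v := by
    rw [← D.chi_glue_eq_iff K u v z', chi_eq_chi_iff]
    simp only [levelSet, Set.mem_ofPred_eq, h]
  exact (key u v ((D.prime K).conn (D.doubleMDS K) hchi)).resolve_right (fun h' => h' z' h) z

/-- The blocks of `y` are replaced by those of `x` one at a time, each without affecting the value
of `g`. -/
theorem PrimeDecomposition.apply_eq (hg : IsQuasigroup g) (hab : a ≠ b)
    (D : PrimeDecomposition (levelSet g {a, b})) {x y : Fin n → Sym}
    (h : ∀ K : {K // K ∈ D.blocks.parts},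
      g (glue K.1 (fun i => x i) fun _ => 0) = g (glue K.1 (fun i => y i) fun _ => 0)) :
    g x = g y := by
  have key : ∀ P ⊆ D.blocks.parts, g ((P.biUnion id).piecewise x y) = g y := by
    intro P
    induction P using Finset.induction_on with
    | empty =>
      intro _
      congr 1
    | insert K P hK ih =>
      intro hP
      rw [insert_subset_iff] at hP
      rw [← ih hP.2]
      have h₁ : ((insert K P).biUnion id).piecewise x y =
          glue K (fun i => x i) ((P.biUnion id).piecewise x y) := by
        ext k
        by_cases hk : k ∈ K <;> simp [Finset.piecewise, glue, hk]
      have h₂ : (P.biUnion id).piecewise x y =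
          glue K (fun i => y i) ((P.biUnion id).piecewise x y) := by
        ext k
        by_cases hk : k ∈ K
        · have : k ∉ P.biUnion id := fun hk' => by
            obtain ⟨L, hL, hkL⟩ := mem_biUnion.1 hk'
            exact hK (D.blocks.eq_of_mem_parts hP.1 (hP.2 hL) hk hkL ▸ hL)
          rw [piecewise_eq_of_notMem _ _ _ this]
          simp [glue, hk]
        · simp [glue, hk]
      rw [h₁]
      conv_rhs => rw [h₂]
      exact D.apply_glue_eq hg hab ⟨K, hP.1⟩ (h ⟨K, hP.1⟩) _
  have := key _ subset_rfl
  rwa [D.blocks.biUnion_parts, piecewise_univ] at this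

theorem PrimeDecomposition.isReducible (hg : IsQuasigroup g) (hab : a ≠ b)
    (D : PrimeDecomposition (levelSet g {a, b})) (h₁ : 1 < D.numBlocks) (hn : D.numBlocks < n) :
    IsReducible g := by
  let h : ∀ K : {K // K ∈ D.blocks.parts}, (K.1 → Sym) → Sym :=
    fun K u => g (glue K.1 u fun _ => 0)
  have hne : ∀ K : {K // K ∈ D.blocks.parts}, Nonempty K.1 := fun K =>
    (D.blocks.nonempty_of_mem_parts K.2).to_subtype
  have hq : ∀ K, IsQuasigroup (h K) := fun K => hg.glue K.1 _
  choose s hs using fun K => (hq K).surjective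
  have hpart : ∀ i, D.blocks.part i ∈ D.blocks.parts := fun i =>
    D.blocks.part_mem.2 (mem_univ i)
  -- The word `w v` realizes the inner values `v`: on each block it is a chosen preimage under `h
  -- K`. The outer operation is then `g` after `w`.
  let w : ({K // K ∈ D.blocks.parts} → Sym) → Fin n → Sym := fun v i =>
    s ⟨_, hpart i⟩ (v ⟨_, hpart i⟩) ⟨i, D.blocks.mem_part_self.2 (mem_univ i)⟩
  have hw : ∀ v K, (fun i : K.1 => w v i) = s K (v K) := by
    rintro v ⟨K, hK⟩
    ext ⟨i, hi⟩
    obtain rfl := D.blocks.part_eq_of_mem hK hi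
    rfl
  have hrep : ∀ x v, (∀ K, h K (fun i => x i) = v K) → g x = g (w v) := by
    intro x v hx
    refine D.apply_eq hg hab fun K => ?_
    rw [hw]
    exact (hx K).trans (hs K (v K)).symm
  refine ⟨D.blocks, fun v => g (w v), h, hn, fun K hK => ?_, ?_, hq, fun x =>
    hrep x _ fun K => rfl⟩
  · obtain ⟨L, hL, hLK⟩ := exists_mem_ne h₁ K
    obtain ⟨i, hi⟩ := D.blocks.nonempty_of_mem_parts hL
    have : K ⊂ univ := (ssubset_univ_iff).2 fun hK' =>
      hLK (D.blocks.eq_of_mem_parts hL hK hi (hK' ▸ mem_univ i))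
    simpa using card_lt_card this
  · intro K v y
    -- To reach `y` by varying argument `K`, solve `g` for one coordinate `i` of that block; only
    -- the inner value at `K` is affected.
    obtain ⟨i, hi⟩ := hne K
    obtain ⟨t, ht⟩ := hg i (w v) y
    refine ⟨h K fun j => update (w v) i t j, ?_⟩
    refine (hrep (update (w v) i t) _ fun L => ?_).symm.trans ht
    by_cases hLK : L = K
    · subst hLK
      simp
    · rw [update_of_ne hLK, ← hs L (v L), ← hw v L]
      congr 1
      ext ⟨j, hj⟩
      have : j ≠ i := by
        rintro rfl
        exact hLK (Subtype.ext (D.blocks.eq_of_mem_parts L.2 K.2 hj hi))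
      simp [this]

end Reducible

/-! ### Semilinearity when all blocks are singletons -/

section Semilinear

variable {n : ℕ} {g : (Fin n → Sym) → Sym} {a b : Sym}

theorem mem_graphCode_iff (w : Fin (n + 1) → Sym) :
    w ∈ graphCode g ↔ g (Fin.init w) = w (Fin.last n) := by
  refine ⟨?_, fun h => ⟨Fin.init w, by simp only [h, Fin.snoc_init_self]⟩⟩
  rintro ⟨x, rfl⟩
  simp

theorem IsQuasigroup.isMDSCode_graphCode (hg : IsQuasigroup g) : IsMDSCode (graphCode g) := by
  intro i x
  rw [lineCount, Set.ncard_eq_one]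
  induction i using Fin.lastCases with
  | last => exact ⟨g (Fin.init x), by ext t; simp [mem_graphCode_iff, eq_comm]⟩
  | cast i =>
    have hb := hg.bijective i (Fin.init x)
    obtain ⟨t, ht⟩ := hb.2 (x (Fin.last n))
    refine ⟨t, ?_⟩
    ext s
    simp only [mem_graphCode_iff, Fin.init_update_castSucc, Set.mem_ofPred_eq,
      Set.mem_singleton_iff, update_of_ne (Fin.castSucc_ne_last i).symm]
    rw [← ht]
    exact hb.1.eq_iff

theorem PrimeDecomposition.isSemilinear (hg : IsQuasigroup g) (hab : a ≠ b)
    (D : PrimeDecomposition (levelSet g {a, b})) (hn : D.numBlocks = n) : IsSemilinear g := by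
  have hsingle : ∀ K ∈ D.blocks.parts, #K = 1 := by
    have hsum : ∑ K ∈ D.blocks.parts, 1 = ∑ K ∈ D.blocks.parts, #K := by
      rw [D.blocks.sum_card_parts, sum_const, smul_eq_mul, mul_one, card_univ, Fintype.card_fin]
      exact hn
    exact fun K hK => ((sum_eq_sum_iff_of_le fun K hK =>
      card_pos.2 (D.blocks.nonempty_of_mem_parts hK)).1 hsum K hK).symm
  have hpart : ∀ i, D.blocks.part i ∈ D.blocks.parts := fun i =>
    D.blocks.part_mem.2 (mem_univ i)
  let F : Fin n → Sym → ZMod 2 := fun i t => chi (D.comp ⟨_, hpart i⟩) fun _ => t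
  have hF : ∀ x, chi (levelSet g {a, b}) x = ∑ i, F i (x i) + D.shift := by
    intro x
    rw [D.chi_eq]
    congr 1
    symm
    refine Fintype.sum_bijective (fun i => ⟨_, hpart i⟩) ⟨fun i j hij => ?_, ?_⟩ _ _ fun i => ?_
    · have hij : D.blocks.part i = D.blocks.part j := congrArg Subtype.val hij
      have hi := D.blocks.mem_part_self.2 (mem_univ i)
      have hj := D.blocks.mem_part_self.2 (mem_univ j)
      rw [hij] at hi
      exact card_le_one.1 (hsingle _ (hpart j)).le i hi j hj
    · rintro ⟨K, hK⟩
      obtain ⟨i, hi⟩ := D.blocks.nonempty_of_mem_parts hK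
      exact ⟨i, Subtype.ext (D.blocks.part_eq_of_mem hK hi)⟩
    · refine congrArg (chi _) ?_
      ext ⟨j, hj⟩
      obtain rfl : j = i := card_le_one.1 (hsingle _ (hpart i)).le j hj i
        (D.blocks.mem_part_self.2 (mem_univ i))
      rfl
  let T : Set (Fin (n + 1) → Sym) :=
    {w | g (Fin.init w) ∈ ({a, b} : Set Sym) ↔ w (Fin.last n) ∈ ({a, b} : Set Sym)}
  refine ⟨hg.isMDSCode_graphCode, T, ⟨?_, ?_⟩, fun w hw => ?_⟩
  · intro i x
    induction i using Fin.lastCases with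
    | last =>
      have := ncard_mem_pair_iff hab bijective_id (g (Fin.init x) ∈ ({a, b} : Set Sym))
      rw [← this, lineCount]
      congr 1
      ext t
      simp only [T, Set.mem_ofPred_eq, Fin.init_update_last, update_self, id]
      exact iff_comm
    | cast i =>
      have := ncard_mem_pair_iff hab (hg.bijective i (Fin.init x))
        (x (Fin.last n) ∈ ({a, b} : Set Sym))
      rw [← this, lineCount]
      congr 1
      ext t
      simp only [T, Set.mem_ofPred_eq, Fin.init_update_castSucc,
        update_of_ne (Fin.castSucc_ne_last i).symm]
  -- Membership in `T` is agreement of two indicators, which costs the `1`; `D.shift` cancels the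
  -- constant left over from the decomposition. Both are absorbed into the function of the last
  -- coordinate.
  · let c : Sym → ZMod 2 := fun t => ({a, b} : Set Sym).indicator (fun _ => 1) t + D.shift + 1
    refine ⟨Fin.snoc (α := fun _ => Sym → ZMod 2) F c, fun w => ?_⟩
    rw [Fin.sum_univ_castSucc]
    simp only [Fin.snoc_castSucc, Fin.snoc_last]
    have h₁ : ∑ i, F i (w (Fin.castSucc i)) = chi (levelSet g {a, b}) (Fin.init w) - D.shift :=
      eq_sub_of_add_eq (hF (Fin.init w)).symm
    have hT : chi T w = chi (levelSet g {a, b}) (Fin.init w) +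
        ({a, b} : Set Sym).indicator (fun _ => 1) (w (Fin.last n)) + 1 := by
      have h₂ : (1 : ZMod 2) + 1 + 1 = 1 ∧ (1 : ZMod 2) + 1 = 0 := by decide
      rw [chi, chi]
      by_cases hi : g (Fin.init w) ∈ ({a, b} : Set Sym) <;>
        by_cases hl : w (Fin.last n) ∈ ({a, b} : Set Sym)
      · rw [Set.indicator_of_mem, Set.indicator_of_mem, Set.indicator_of_mem hl, h₂.1]
        exacts [hi, iff_of_true hi hl]
      · rw [Set.indicator_of_notMem, Set.indicator_of_mem, Set.indicator_of_notMem hl, add_zero,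
          h₂.2]
        exacts [hi, fun h => hl (h.1 hi)]
      · rw [Set.indicator_of_notMem, Set.indicator_of_notMem, Set.indicator_of_mem hl, zero_add,
          h₂.2]
        exacts [hi, fun h => hi (h.2 hl)]
      · rw [Set.indicator_of_mem, Set.indicator_of_notMem, Set.indicator_of_notMem hl, add_zero,
          zero_add]
        exacts [hi, iff_of_false hi hl]
    rw [h₁, hT]
    simp only [c]
    ring
  · rw [mem_graphCode_iff] at hw
    simp only [T, Set.mem_ofPred_eq, hw]

end Semilinear

end MDSFour

theorem mainTheorem7 (n : ℕ) (hn : 1 ≤ n)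
    (g : (Fin n → MDSFour.Sym) → MDSFour.Sym) (hg : MDSFour.IsQuasigroup g)
    (a b : MDSFour.Sym) (hab : a ≠ b) :
    Nonempty (MDSFour.PrimeDecomposition (MDSFour.levelSet g {a, b})) ∧
      ∀ D : MDSFour.PrimeDecomposition (MDSFour.levelSet g {a, b}),
        (1 < D.numBlocks ∧ D.numBlocks < n → MDSFour.IsReducible g) ∧
        (D.numBlocks = n → MDSFour.IsSemilinear g) :=
  ⟨MDSFour.exists_primeDecomposition (hg.isDoubleMDSCode_levelSet hab), fun D =>
    ⟨fun h => D.isReducible hg hab h.1 h.2, D.isSemilinear hg hab⟩⟩
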